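/- Let $\Sigma=\{0,1\}$. For $x,y\in\Sigma^*$ let $\langle x,y\rangle = x_1x_1x_2x_2\cdots x_{|x|}x_{|x|}\,01\,y_1y_1y_2y_2\cdots y_{|y|}y_{|y|}\in\Sigma^*$. An equivalence relation $R$ on $\Sigma^*$ is identified with the language $L_R=\{\langle x,y\rangle : (x,y)\in R\}$. Let $\mathrm{NPEq}$ be the class of equivalence relations $R$ on $\Sigma^*$ such that $L_R\in\mathrm{NP}$, i.e. $L_R$ is decided by a nondeterministic Turing machine in polynomial time. For equivalence relations $R,S$ on $\Sigma^*$, a polynomial-time kernel reduction from $R$ to $S$ is a polynomial-time computable function $f\colon\Sigma^*\to\Sigma^*$ such that $(x,y)\in R\iff (f(x),f(y))\in S$ for all $x,y\in\Sigma^*$. An equivalence relation $R$ on $\Sigma^*$ is $\mathrm{NPEq}$-complete if $R\in\mathrm{NPEq}$ and every equivalence relation in $\mathrm{NPEq}$ has a polynomial-time kernel reduction to $R$. Corollary. If an equivalence relation $R$ on $\Sigma^*$ is $\mathrm{NPEq}$-complete, then $L_R$ is $\mathrm{NP}$-complete under polynomial-time many-one reductions. -/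

import Mathlib

namespace KernelRed

/-- Binary strings. -/
abbrev Str : Type := List Bool

/-- The pairwise encoding `x₁x₁x₂x₂⋯xₙxₙ 01 y₁y₁y₂y₂⋯yₘyₘ` of two binary strings. -/
def pair (x y : Str) : Str :=
  x.flatMap (fun b => [b, b]) ++ [false, true] ++ y.flatMap (fun b => [b, b])

/-- The language over the binary alphabet induced by an equivalence relation on binary strings. -/
def inducedLang (R : Setoid Str) : Language Bool :=
  {z | ∃ x y : Str, R x y ∧ z = pair x y}

/-- The class FP: functions on binary strings computed by a deterministic (multi-stack) Turing
machine in polynomial time. -/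
def PolyTime (f : Str → Str) : Prop :=
  Nonempty (Turing.TM2ComputableInPolyTime (id : Str → List Bool) (id : Str → List Bool) f)

/-- A nondeterministic Turing machine. This is the nondeterministic version of Mathlib's
deterministic machine model `Turing.FinTM2`: finitely many stacks, finite alphabets, finitely many
labels and internal states, and for each label a finite list of statements, one of which is chosen
whenever a step is made at that label. -/
structure NTM where
  /-- index type of the stacks -/
  K : Type
  [decEqK : DecidableEq K]
  [finK : Fintype K]
  /-- the stack alphabets -/
  Γ : K → Type
  [finΓ : ∀ k, Fintype (Γ k)]
  /-- the input stack -/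
  k₀ : K
  /-- how the symbols 0 and 1 are written on the input stack -/
  inp : Bool ↪ Γ k₀
  /-- labels -/
  Λ : Type
  [finΛ : Fintype Λ]
  /-- the label at which the computation starts -/
  main : Λ
  /-- internal states -/
  σ : Type
  [finσ : Fintype σ]
  /-- the internal state in which the computation starts -/
  start : σ
  /-- the internal states in which a halted computation accepts -/
  accept : Set σ
  /-- the program: the statements among which the machine can choose at each label -/
  prog : Λ → List (Turing.TM2.Stmt Γ Λ σ)

attribute [instance] NTM.decEqK NTM.finK NTM.finΓ NTM.finΛ NTM.finσ

namespace NTM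

/-- Configurations: the current label (`none` if halted), internal state, and stack contents. -/
abbrev Cfg (N : NTM) : Type := Turing.TM2.Cfg N.Γ N.Λ N.σ

/-- The initial configuration on input `x`: `x` is on the input stack with its first symbol on top,
and all the other stacks are empty. -/
def init (N : NTM) (x : Str) : N.Cfg where
  l := some N.main
  var := N.start
  stk := Function.update (fun _ => []) N.k₀ (x.map N.inp)

/-- `N.Step c d`: the machine can move from `c` to `d` in one step. -/
def Step (N : NTM) (c d : N.Cfg) : Prop :=
  ∃ l : N.Λ, c.l = some l ∧ ∃ q ∈ N.prog l, d = Turing.TM2.stepAux q c.var c.stk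

/-- `N.ReachesIn n c d`: some computation path of exactly `n` steps leads from `c` to `d`. -/
def ReachesIn (N : NTM) : ℕ → N.Cfg → N.Cfg → Prop
  | 0, c, d => c = d
  | n + 1, c, d => ∃ e, N.Step c e ∧ N.ReachesIn n e d

/-- On input `x` the machine halts in time `t`: no computation path has more than `t` steps. -/
def HaltsInTime (N : NTM) (x : Str) (t : ℕ) : Prop :=
  ∀ (n : ℕ) (d : N.Cfg), N.ReachesIn n (N.init x) d → n ≤ t

/-- The machine accepts `x`: some computation path halts in an accepting state. -/
def Accepts (N : NTM) (x : Str) : Prop :=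
  ∃ (n : ℕ) (d : N.Cfg), N.ReachesIn n (N.init x) d ∧ d.l = none ∧ d.var ∈ N.accept

end NTM

/-- The class NP: languages decided by a nondeterministic Turing machine in polynomial time. -/
def InNP (L : Language Bool) : Prop :=
  ∃ (N : NTM) (p : Polynomial ℕ), ∀ x : Str,
    N.HaltsInTime x (p.eval x.length) ∧ (x ∈ L ↔ N.Accepts x)

/-- Polynomial-time many-one reducibility of languages. -/
def ManyOneReduces (A B : Language Bool) : Prop :=
  ∃ f : Str → Str, PolyTime f ∧ ∀ w : Str, w ∈ A ↔ f w ∈ B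

/-- NP-completeness (under polynomial-time many-one reductions). -/
def NPComplete (L : Language Bool) : Prop :=
  InNP L ∧ ∀ A : Language Bool, InNP A → ManyOneReduces A L

/-- The class NPEq: equivalence relations whose induced language is in NP. -/
def InNPEq (R : Setoid Str) : Prop := InNP (inducedLang R)

/-- Polynomial-time kernel reducibility of equivalence relations. -/
def KernelReduces (R S : Setoid Str) : Prop :=
  ∃ f : Str → Str, PolyTime f ∧ ∀ x y : Str, R x y ↔ S (f x) (f y)

/-- NPEq-completeness (under polynomial-time kernel reductions). -/
def NPEqComplete (S : Setoid Str) : Prop :=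
  InNPEq S ∧ ∀ R : Setoid Str, InNPEq R → KernelReduces R S

end KernelRed

/-!
To reduce `A ∈ NP` to `L_R`, let `S` be the equivalence relation that identifies `0w` with `1w` for
`w ∈ A` and is equality otherwise. Then `L_S ∈ NP`: given `⟨x, y⟩`, check deterministically whether
`x = y`, or else whether `x` and `y` differ exactly in the first symbol, and in the latter case
decide nondeterministically whether their common tail is in `A`. A kernel reduction `f` from `S` to
`R` turns into the many-one reduction `w ↦ ⟨f (0w), f (1w)⟩` from `A` to `L_R`.
-/

namespace KernelRed

open Function Turing Turing.TM2 StateTransition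

section Strings

/-- The string `x₁x₁x₂x₂⋯xₙxₙ`, of which both halves of `pair` are made. -/
def double (x : Str) : Str := x.flatMap fun b => [b, b]

@[simp]
theorem double_cons (b : Bool) (x : Str) : double (b :: x) = b :: b :: double x := rfl

theorem foldl_double (w v : Str) :
    w.foldl (fun v b => b :: b :: v) v = double w.reverse ++ v := by
  induction w generalizing v with
  | nil => rfl
  | cons b w ih => simp [ih, double]

theorem pair_eq (x y : Str) : pair x y = double x ++ false :: true :: double y := by
  simp [pair, double]

theorem pair_nil (y : Str) : pair [] y = false :: true :: double y := rfl

theorem pair_cons (a : Bool) (x y : Str) : pair (a :: x) y = a :: a :: pair x y := rfl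

theorem singleton_ne_double (a : Bool) : ∀ x : Str, [a] ≠ double x
  | [] => by simp [double]
  | _ :: _ => by simp

theorem two_le_length_pair (x y : Str) : 2 ≤ (pair x y).length := by
  simp only [pair_eq, List.length_append, List.length_cons]
  omega

theorem cons_cons_eq_double_iff {a b : Bool} {z x : Str} :
    a :: b :: z = double x ↔ a = b ∧ ∃ x', x = a :: x' ∧ z = double x' := by
  cases x with
  | nil => simp [double]
  | cons c x =>
    simp only [double_cons, List.cons.injEq]
    grind

theorem cons_cons_eq_pair_iff {a b : Bool} {z x y : Str} :
    a :: b :: z = pair x y ↔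
      (a = b ∧ ∃ x', x = a :: x' ∧ z = pair x' y) ∨
        a = false ∧ b = true ∧ x = [] ∧ z = double y := by
  cases x with
  | nil => simp [pair_nil]
  | cons c x =>
    simp only [pair_cons, List.cons.injEq]
    grind

theorem double_injective : Injective double := by
  intro x
  induction x with
  | nil =>
    rintro (_ | ⟨b, y⟩) h
    · rfl
    · cases h
  | cons a x ih =>
    intro y h
    obtain ⟨-, y, rfl, h'⟩ := cons_cons_eq_double_iff.1 h
    rw [ih h']

theorem pair_inj {x y x' y' : Str} : pair x y = pair x' y' ↔ x = x' ∧ y = y' := by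
  refine ⟨fun h => ?_, fun ⟨hx, hy⟩ => hx ▸ hy ▸ rfl⟩
  induction x generalizing x' with
  | nil =>
    rcases cons_cons_eq_pair_iff.1 h with ⟨h', -⟩ | ⟨-, -, rfl, h'⟩
    · cases h'
    · exact ⟨rfl, double_injective h'⟩
  | cons a x ih =>
    rcases cons_cons_eq_pair_iff.1 h with ⟨-, x', rfl, h'⟩ | ⟨rfl, h', -⟩
    · obtain ⟨rfl, rfl⟩ := ih h'
      exact ⟨rfl, rfl⟩
    · cases h'

theorem pair_mem_inducedLang {R : Setoid Str} {x y : Str} :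
    pair x y ∈ inducedLang R ↔ R x y := by
  constructor
  · rintro ⟨x', y', h, e⟩
    obtain ⟨rfl, rfl⟩ := pair_inj.1 e
    exact h
  · exact fun h => ⟨x, y, h, rfl⟩

end Strings

section Subroutine

/-- A way to run a machine with labels `Λ` and internal states `σ` as a part of a host machine with
stack alphabets `Γ`, labels `Λ'` and internal states `σ'`. The stacks of the subroutine are stacks
of the host with the same alphabets, and its internal state is a component of that of the host,
accessed by the lens `get`, `set`. Where the subroutine would halt, the host executes `exit`. -/
structure Subroutine (K Λ σ : Type) {K' : Type} (Γ : K' → Type) (Λ' σ' : Type) where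
  stack : K ↪ K'
  label : Λ → Λ'
  get : σ' → σ
  set : σ' → σ → σ'
  get_set (s : σ') (v : σ) : get (set s v) = v
  set_set (s : σ') (v w : σ) : set (set s v) w = set s w
  exit : Stmt Γ Λ' σ'

namespace Subroutine

variable {K K' Λ Λ' σ σ' : Type} {Γ : K' → Type} (e : Subroutine K Λ σ Γ Λ' σ')

/-- The statement of the host machine that carries out a statement of the subroutine. -/
def liftStmt : Stmt (fun k => Γ (e.stack k)) Λ σ → Stmt Γ Λ' σ'
  | .push k f q => .push (e.stack k) (fun s => f (e.get s)) (liftStmt q)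
  | .peek k f q => .peek (e.stack k) (fun s a => e.set s (f (e.get s) a)) (liftStmt q)
  | .pop k f q => .pop (e.stack k) (fun s a => e.set s (f (e.get s) a)) (liftStmt q)
  | .load f q => .load (fun s => e.set s (f (e.get s))) (liftStmt q)
  | .branch f q₁ q₂ => .branch (fun s => f (e.get s)) (liftStmt q₁) (liftStmt q₂)
  | .goto f => .goto fun s => e.label (f (e.get s))
  | .halt => e.exit

open Classical in
/-- The stack contents `S'` of the host, overwritten with `S` on the stacks of the subroutine. -/
noncomputable def overwrite (S' : ∀ k, List (Γ k)) (S : ∀ k, List (Γ (e.stack k))) (j : K') :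
    List (Γ j) :=
  if h : ∃ k, e.stack k = j then h.choose_spec ▸ S h.choose else S' j

@[simp]
theorem overwrite_stack (S' : ∀ k, List (Γ k)) (S : ∀ k, List (Γ (e.stack k))) (k : K) :
    e.overwrite S' S (e.stack k) = S k := by
  have cast_eq : ∀ (k' : K) (h : e.stack k' = e.stack k), h ▸ S k' = S k := by
    intro k' h
    obtain rfl := e.stack.injective h
    rfl
  have h : ∃ k', e.stack k' = e.stack k := ⟨k, rfl⟩
  rw [overwrite, dif_pos h, cast_eq]

theorem overwrite_of_ne (S' : ∀ k, List (Γ k)) (S : ∀ k, List (Γ (e.stack k))) {j : K'}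
    (h : ∀ k, e.stack k ≠ j) : e.overwrite S' S j = S' j :=
  dif_neg fun ⟨k, hk⟩ => h k hk

theorem eq_overwrite_iff {S' T : ∀ k, List (Γ k)} {S : ∀ k, List (Γ (e.stack k))} :
    T = e.overwrite S' S ↔
      (∀ k, T (e.stack k) = S k) ∧ ∀ j, (∀ k, e.stack k ≠ j) → T j = S' j := by
  constructor
  · rintro rfl
    exact ⟨e.overwrite_stack S' S, fun j => e.overwrite_of_ne S' S⟩
  · rintro ⟨h, h'⟩
    funext j
    by_cases hj : ∃ k, e.stack k = j
    · obtain ⟨k, rfl⟩ := hj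
      rw [h, overwrite_stack]
    · rw [h' j (not_exists.1 hj), overwrite_of_ne _ _ _ (not_exists.1 hj)]

variable [DecidableEq K] [DecidableEq K']

@[simp]
theorem update_overwrite (S' : ∀ k, List (Γ k)) (S : ∀ k, List (Γ (e.stack k))) (k : K)
    (s : List (Γ (e.stack k))) :
    update (e.overwrite S' S) (e.stack k) s = e.overwrite S' (update S k s) := by
  refine e.eq_overwrite_iff.2 ⟨fun i => ?_, fun j hj => ?_⟩
  · rcases eq_or_ne i k with rfl | h
    · simp
    · rw [update_of_ne (e.stack.injective.ne h), update_of_ne h, overwrite_stack]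
  · rw [update_of_ne (hj k).symm, e.overwrite_of_ne S' S hj]

/-- The configuration of the host that corresponds to a configuration of the subroutine, where `s`
and `S'` provide the data of the host outside of the subroutine. If the subroutine has halted, then
the host has already executed `exit`. -/
noncomputable def liftCfg (s : σ') (S' : ∀ k, List (Γ k)) :
    Cfg (fun k => Γ (e.stack k)) Λ σ → Cfg Γ Λ' σ'
  | ⟨some l, v, S⟩ => ⟨some (e.label l), e.set s v, e.overwrite S' S⟩
  | ⟨none, v, S⟩ => stepAux e.exit (e.set s v) (e.overwrite S' S)

theorem stepAux_liftStmt (s : σ') (S' : ∀ k, List (Γ k)) (q : Stmt (fun k => Γ (e.stack k)) Λ σ)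
    (v : σ) (S : ∀ k, List (Γ (e.stack k))) :
    stepAux (e.liftStmt q) (e.set s v) (e.overwrite S' S) = e.liftCfg s S' (stepAux q v S) := by
  induction q generalizing v S with
  | push k f _ ih => simp only [liftStmt, stepAux, get_set, overwrite_stack, update_overwrite, ih]
  | peek k f _ ih => simp only [liftStmt, stepAux, get_set, set_set, overwrite_stack, ih]
  | pop k f _ ih =>
    simp only [liftStmt, stepAux, get_set, set_set, overwrite_stack, update_overwrite, ih]
  | load f _ ih => simp only [liftStmt, stepAux, get_set, set_set, ih]
  | branch f _ _ ih₁ ih₂ =>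
    simp only [liftStmt, stepAux, get_set]
    cases f v
    · exact ih₂ v S
    · exact ih₁ v S
  | goto f => simp only [liftStmt, stepAux, liftCfg, get_set]
  | halt => rfl

end Subroutine

end Subroutine

section Evaluation

/-- Iterating the partial function `f`, one gets from `a` to `b` in at most `t` steps. -/
inductive ReachesWithin {α : Type*} (f : α → Option α) : ℕ → α → α → Prop
  | refl (t : ℕ) (a : α) : ReachesWithin f t a a
  | step {t : ℕ} {a b c : α} :
      f a = some b → ReachesWithin f t b c → ReachesWithin f (t + 1) a c

namespace ReachesWithin

variable {α β : Type*} {f : α → Option α} {a b c : α} {s t : ℕ}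

theorem mono (h : ReachesWithin f s a b) (hst : s ≤ t) : ReachesWithin f t a b := by
  induction h generalizing t with
  | refl => exact refl t _
  | step ha _ ih =>
    obtain ⟨t, rfl⟩ := Nat.exists_eq_add_of_le' (Nat.one_le_of_lt hst)
    exact step ha (ih (Nat.le_of_succ_le_succ hst))

theorem trans (h : ReachesWithin f s a b) (h' : ReachesWithin f t b c) :
    ReachesWithin f (s + t) a c := by
  induction h with
  | refl => exact h'.mono (Nat.le_add_left _ _)
  | step ha _ ih => exact (step ha (ih h')).mono (by omega)

theorem map {g : β → Option β} (φ : α → β) (hφ : ∀ a b, f a = some b → g (φ a) = some (φ b))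
    (h : ReachesWithin f t a b) : ReachesWithin g t (φ a) (φ b) := by
  induction h with
  | refl => exact refl _ _
  | step ha _ ih => exact step (hφ _ _ ha) ih

theorem le_add_mul (μ : α → ℕ) {C : ℕ} (hμ : ∀ a b, f a = some b → μ b ≤ μ a + C)
    (h : ReachesWithin f t a b) : μ b ≤ μ a + t * C := by
  induction h with
  | refl => exact Nat.le_add_right _ _
  | step ha _ ih =>
    have := hμ _ _ ha
    rw [Nat.succ_mul]
    omega

theorem foldl {γ : Type*} {D : List γ → β → α} {g : β → γ → β}
    (cons : ∀ x w v, f (D (x :: w) v) = some (D w (g v x))) {w : List γ} {v : β}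
    (nil : f (D [] (w.foldl g v)) = some c) : ReachesWithin f (w.length + 1) (D w v) c := by
  induction w generalizing v with
  | nil => exact step nil (refl 0 c)
  | cons x w ih => exact step (cons x w v) (ih nil)

end ReachesWithin

theorem nonempty_evalsToInTime_iff {α : Type*} {f : α → Option α} {a b : α} {t : ℕ} :
    Nonempty (EvalsToInTime f a (some b) t) ↔ ReachesWithin f t a b := by
  constructor
  · rintro ⟨⟨n, h⟩, hn⟩
    refine ReachesWithin.mono ?_ hn
    clear hn
    induction n generalizing a with
    | zero => cases h; exact .refl _ _
    | succ n ih =>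
      rw [iterate_succ_apply] at h
      rcases ha : f a with _ | a'
      · have none_fixed : (flip bind f)^[n] none = none := iterate_fixed rfl n
        exact absurd ((none_fixed.symm.trans (congrArg _ ha.symm)).trans h) (by simp)
      · exact .step ha (ih ((congrArg _ ha.symm).trans h))
  · intro h
    induction h with
    | refl t a => exact ⟨⟨EvalsTo.refl f a, Nat.zero_le t⟩⟩
    | step ha _ ih =>
      obtain ⟨⟨n, h⟩, hn⟩ := ih
      exact ⟨⟨⟨n + 1, (congrArg _ ha).trans h⟩, Nat.succ_le_succ hn⟩⟩

theorem Subroutine.reachesWithin {K K' Λ Λ' σ σ' : Type} [DecidableEq K] [DecidableEq K']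
    {Γ : K' → Type} (e : Subroutine K Λ σ Γ Λ' σ') {P : Λ → Stmt (fun k => Γ (e.stack k)) Λ σ}
    {P' : Λ' → Stmt Γ Λ' σ'} (hP : ∀ l, P' (e.label l) = e.liftStmt (P l)) (s : σ')
    (S' : ∀ k, List (Γ k)) {t : ℕ} {c d : Cfg (fun k => Γ (e.stack k)) Λ σ}
    (h : ReachesWithin (TM2.step P) t c d) :
    ReachesWithin (TM2.step P') t (e.liftCfg s S' c) (e.liftCfg s S' d) := by
  refine h.map _ fun c d hcd => ?_
  obtain ⟨_ | l, v, S⟩ := c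
  · cases hcd
  · cases hcd
    rw [← e.stepAux_liftStmt, ← hP]
    rfl

/-- A bound on the number of symbols that a statement pushes onto the stacks. -/
def pushBound {K : Type} {Γ : K → Type} {Λ σ : Type} : Stmt Γ Λ σ → ℕ
  | .push _ _ q => pushBound q + 1
  | .peek _ _ q => pushBound q
  | .pop _ _ q => pushBound q
  | .load _ q => pushBound q
  | .branch _ q₁ q₂ => max (pushBound q₁) (pushBound q₂)
  | .goto _ => 0
  | .halt => 0

theorem length_stepAux_le {K : Type} [DecidableEq K] {Γ : K → Type} {Λ σ : Type}
    (q : Stmt Γ Λ σ) (v : σ) (S : ∀ k, List (Γ k)) (k : K) :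
    ((stepAux q v S).stk k).length ≤ (S k).length + pushBound q := by
  induction q generalizing v S with
  | push j _ _ ih =>
    refine (ih v _).trans ?_
    rcases eq_or_ne k j with rfl | h
    · rw [update_self, List.length_cons, pushBound]
      omega
    · rw [update_of_ne h, pushBound]
      omega
  | peek _ _ _ ih => exact ih _ _
  | pop j _ _ ih =>
    refine (ih _ _).trans ?_
    rcases eq_or_ne k j with rfl | h
    · rw [update_self, List.length_tail, pushBound]
      omega
    · rw [update_of_ne h, pushBound]
  | load _ _ ih => exact ih _ _
  | branch f _ _ ih₁ ih₂ =>
    rw [stepAux, pushBound]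
    cases f v
    · exact (ih₂ v S).trans (Nat.add_le_add_left (le_max_right _ _) _)
    · exact (ih₁ v S).trans (Nat.add_le_add_left (le_max_left _ _) _)
  | goto => exact Nat.le_add_right _ _
  | halt => exact Nat.le_add_right _ _

theorem initList_eq (M : FinTM2) (w : List (M.Γ M.k₀)) :
    initList M w = ⟨some M.main, M.initialState, update (fun _ => []) M.k₀ w⟩ := by
  refine congrArg (Cfg.mk _ _) (funext fun k => ?_)
  by_cases h : k = M.k₀
  · subst h
    rw [dif_pos rfl, update_self]
    rfl
  · rw [dif_neg h, update_of_ne h]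

theorem haltList_eq (M : FinTM2) (w : List (M.Γ M.k₁)) :
    haltList M w = ⟨none, M.initialState, update (fun _ => []) M.k₁ w⟩ := by
  refine congrArg (Cfg.mk _ _) (funext fun k => ?_)
  by_cases h : k = M.k₁
  · subst h
    rw [dif_pos rfl, update_self]
    rfl
  · rw [dif_neg h, update_of_ne h]

end Evaluation

section PolyTime

theorem polyTime_iff {f : Str → Str} :
    PolyTime f ↔ ∃ (M : FinTM2) (ei : M.Γ M.k₀ ≃ Bool) (eo : M.Γ M.k₁ ≃ Bool) (p : Polynomial ℕ),
      ∀ w : Str, ReachesWithin (TM2.step M.m) (p.eval w.length)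
        ⟨some M.main, M.initialState, update (fun _ => []) M.k₀ (w.map ei.symm)⟩
        ⟨none, M.initialState, update (fun _ => []) M.k₁ ((f w).map eo.symm)⟩ := by
  simp only [← initList_eq, ← haltList_eq]
  constructor
  · rintro ⟨⟨⟨M, ei, eo⟩, p, h⟩⟩
    exact ⟨M, ei, eo, p, fun w => nonempty_evalsToInTime_iff.1 ⟨h w⟩⟩
  · rintro ⟨M, ei, eo, p, h⟩
    exact ⟨⟨⟨M, ei, eo⟩, p, fun w => (nonempty_evalsToInTime_iff.2 (h w)).some⟩⟩

theorem polynomial_eval_mono (p : Polynomial ℕ) : Monotone fun n => p.eval n := fun m n h => by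
  simp only [Polynomial.eval_eq_sum]
  exact Finset.sum_le_sum fun i _ => Nat.mul_le_mul_left _ (Nat.pow_le_pow_left h i)

theorem PolyTime.exists_length_le {f : Str → Str} (hf : PolyTime f) :
    ∃ q : Polynomial ℕ, ∀ w, (f w).length ≤ q.eval w.length := by
  obtain ⟨M, ei, eo, p, h⟩ := polyTime_iff.1 hf
  have := M.ΛFin
  let C := ∑ l, pushBound (M.m l)
  have step_le : ∀ c d, TM2.step M.m c = some d →
      (d.stk M.k₁).length ≤ (c.stk M.k₁).length + C := by
    rintro ⟨_ | l, v, S⟩ d hd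
    · cases hd
    · cases hd
      exact (length_stepAux_le _ v S _).trans <| Nat.add_le_add_left
        (Finset.single_le_sum (f := fun l => pushBound (M.m l)) (fun _ _ => Nat.zero_le _)
          (Finset.mem_univ l)) _
  have init_le : ∀ w : List (M.Γ M.k₀),
      (update (fun k => ([] : List (M.Γ k))) M.k₀ w M.k₁).length ≤ w.length := by
    intro w
    by_cases h₁ : M.k₁ = M.k₀
    · rw [h₁, update_self]
    · rw [update_of_ne h₁]
      exact Nat.zero_le _
  refine ⟨.X + p * .C C, fun w => ?_⟩
  have bound := (h w).le_add_mul (fun c => (c.stk M.k₁).length) step_le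
  have start := init_le (w.map ei.symm)
  simp only [update_self, List.length_map] at bound start
  simp only [Polynomial.eval_add, Polynomial.eval_mul, Polynomial.eval_X, Polynomial.eval_C]
  omega

/-- `M` as a subroutine of a machine with one more label, at which the host starts. -/
def consSubroutine (M : FinTM2) : Subroutine M.K M.Λ M.σ M.Γ (Option M.Λ) M.σ where
  stack := .refl M.K
  label := some
  get := id
  set _ v := v
  get_set _ _ := rfl
  set_set _ _ _ := rfl
  exit := .halt

/-- The program that pushes `a` onto the input stack of `M` and then runs `M`. -/
def consProg (M : FinTM2) (a : M.Γ M.k₀) : Option M.Λ → Stmt M.Γ (Option M.Λ) M.σ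
  | none => .push M.k₀ (fun _ => a) (.goto fun _ => some M.main)
  | some l => (consSubroutine M).liftStmt (M.m l)

/-- The machine with program `consProg M a`. -/
def consTM (M : FinTM2) (a : M.Γ M.k₀) : FinTM2 :=
  have := M.ΛFin
  { K := M.K
    kFin := M.kFin
    k₀ := M.k₀
    k₁ := M.k₁
    Γ := M.Γ
    Λ := Option M.Λ
    main := none
    σ := M.σ
    initialState := M.initialState
    σFin := M.σFin
    Γk₀Fin := M.Γk₀Fin
    m := consProg M a }

theorem reachesWithin_consProg {M : FinTM2} {a : M.Γ M.k₀} {w : List (M.Γ M.k₀)} {t : ℕ} {v : M.σ}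
    {S : ∀ k, List (M.Γ k)}
    (h : ReachesWithin (TM2.step M.m) t
      ⟨some M.main, M.initialState, update (fun _ => []) M.k₀ (a :: w)⟩ ⟨none, v, S⟩) :
    ReachesWithin (TM2.step (consProg M a)) (t + 1)
      ⟨some none, M.initialState, update (fun _ => []) M.k₀ w⟩ ⟨none, v, S⟩ := by
  have overwrite_eq (S' S : ∀ k, List (M.Γ k)) : (consSubroutine M).overwrite S' S = S :=
    funext fun k => (consSubroutine M).overwrite_stack S' S k
  have run := (consSubroutine M).reachesWithin (P' := consProg M a) (fun _ => rfl)
    M.initialState (fun _ => []) h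
  simp only [Subroutine.liftCfg] at run
  rw [overwrite_eq, overwrite_eq] at run
  refine .step ?_ run
  simp only [TM2.step, consProg, stepAux, update_self, update_idem]
  rfl

theorem PolyTime.comp_cons {f : Str → Str} (hf : PolyTime f) (b : Bool) :
    PolyTime fun w => f (b :: w) := by
  obtain ⟨M, ei, eo, p, h⟩ := polyTime_iff.1 hf
  refine polyTime_iff.2 ⟨consTM M (ei.symm b), ei, eo, p.comp (.X + 1) + 1, fun w => ?_⟩
  simp only [Polynomial.eval_add, Polynomial.eval_comp, Polynomial.eval_X, Polynomial.eval_one]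
  exact reachesWithin_consProg (h (b :: w))

/-- The stacks that the machine for `PolyTime.pair` has in addition to those of its two
subroutines: one for its input and output, and one for reversing strings. -/
inductive PairStack
  | io | tmp
  deriving DecidableEq

instance : Fintype PairStack := ⟨{.io, .tmp}, fun k => by cases k <;> simp⟩

/-- The phases of the machine for `PolyTime.pair` other than the runs of its two subroutines. The
input is moved to `tmp` (`split`) and from there to the input stacks of both subroutines (`feed`).
The output of subroutine `b` is moved to `tmp` (`drain b`) and from there, with every symbol
doubled, to the output stack (`emit b`). As strings are written from their end, subroutine `true`
for the second component runs first. -/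
inductive PairLabel
  | split | feed | drain (b : Bool) | emit (b : Bool)
  deriving Fintype

section PairMachine

variable (M : Bool → FinTM2)

/-- The stack alphabets of the machine for `PolyTime.pair`. -/
abbrev PairAlphabet : PairStack ⊕ (Σ b, (M b).K) → Type
  | .inl _ => Bool
  | .inr k => (M k.1).Γ k.2

/-- The labels of the machine for `PolyTime.pair`. -/
abbrev PairLabels : Type := PairLabel ⊕ Σ b, (M b).Λ

/-- The internal states of the machine for `PolyTime.pair`: a register for the symbol that is being
moved, and the states of the subroutines. -/
abbrev PairState : Type := Option Bool × ∀ b, (M b).σ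

/-- The statements of the machine for `PolyTime.pair`. -/
abbrev PairStmt : Type := Stmt (PairAlphabet M) (PairLabels M) (PairState M)

/-- The stack contents of the machine for `PolyTime.pair`. -/
def pairStk (io tmp : Str) (S : ∀ b k, List ((M b).Γ k)) : ∀ k, List (PairAlphabet M k)
  | .inl .io => io
  | .inl .tmp => tmp
  | .inr k => S k.1 k.2

/-- Pops a symbol off the stack `k` into the register, and continues with `q₁` if there was one and
with `q₂` if the stack was empty. -/
def popCase (k : PairStack ⊕ Σ b, (M b).K) (φ : PairAlphabet M k → Bool) (q₁ q₂ : PairStmt M) :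
    PairStmt M :=
  .pop k (fun s a => (a.map φ, s.2)) (.branch (fun s => s.1.isSome) q₁ q₂)

/-- Clears the register and continues at the label `l`. -/
def clearGoto (l : PairLabel) : PairStmt M :=
  .load (fun s => (none, s.2)) (.goto fun _ => .inl l)

/-- What the machine for `PolyTime.pair` does when the output of subroutine `b` is on the output
stack. -/
def pairFinish : Bool → PairStmt M
  | true => .push (.inl .io) (fun _ => true) <| .push (.inl .io) (fun _ => false) <|
      .goto fun _ => .inr ⟨false, (M false).main⟩
  | false => .halt

variable (ei : ∀ b, (M b).Γ (M b).k₀ ≃ Bool) (eo : ∀ b, (M b).Γ (M b).k₁ ≃ Bool)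

/-- Machine `b` as a subroutine of the machine for `PolyTime.pair`. -/
def pairSubroutine (b : Bool) :
    Subroutine (M b).K (M b).Λ (M b).σ (PairAlphabet M) (PairLabels M) (PairState M) where
  stack := ⟨fun k => .inr ⟨b, k⟩, Sum.inr_injective.comp sigma_mk_injective⟩
  label l := .inr ⟨b, l⟩
  get s := s.2 b
  set s v := (s.1, update s.2 b v)
  get_set _ _ := update_self ..
  set_set _ _ _ := congrArg _ (update_idem ..)
  exit := .goto fun _ => .inl (.drain b)

/-- The program of the machine for `PolyTime.pair`. -/
def pairProg : PairLabels M → PairStmt M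
  | .inl .split => popCase M (.inl .io) id
      (.push (.inl .tmp) (fun s => s.1.getD false) <| clearGoto M .split)
      (.goto fun _ => .inl .feed)
  | .inl .feed => popCase M (.inl .tmp) id
      (.push (.inr ⟨true, (M true).k₀⟩) (fun s => (ei true).symm (s.1.getD false)) <|
        .push (.inr ⟨false, (M false).k₀⟩) (fun s => (ei false).symm (s.1.getD false)) <|
        clearGoto M .feed)
      (.goto fun _ => .inr ⟨true, (M true).main⟩)
  | .inl (.drain b) => popCase M (.inr ⟨b, (M b).k₁⟩) (eo b)
      (.push (.inl .tmp) (fun s => s.1.getD false) <| clearGoto M (.drain b))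
      (.goto fun _ => .inl (.emit b))
  | .inl (.emit b) => popCase M (.inl .tmp) id
      (.push (.inl .io) (fun s => s.1.getD false) <|
        .push (.inl .io) (fun s => s.1.getD false) <| clearGoto M (.emit b))
      (pairFinish M b)
  | .inr l => (pairSubroutine M l.1).liftStmt ((M l.1).m l.2)

/-- The initial, and also the final, internal state of the machine for `PolyTime.pair`. -/
abbrev pairStart : PairState M := (none, fun b => (M b).initialState)

/-- The machine with program `pairProg M ei eo`. -/
def pairTM : FinTM2 :=
  have := fun b => (M b).kFin
  have := fun b => (M b).ΛFin
  have := fun b => (M b).σFin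
  { K := PairStack ⊕ Σ b, (M b).K
    k₀ := .inl .io
    k₁ := .inl .io
    Γ := PairAlphabet M
    Λ := PairLabels M
    main := .inl .split
    σ := PairState M
    initialState := pairStart M
    Γk₀Fin := inferInstanceAs (Fintype Bool)
    m := pairProg M ei eo }

variable {M ei eo}

theorem pairStk_io (s : Str) :
    pairStk M s [] (fun _ _ => []) =
      update (fun k => ([] : List (PairAlphabet M k))) (.inl .io)
        (s.map (Equiv.refl Bool).symm) := by
  funext k
  rcases k with (_ | _) | k
  · exact (List.map_id s).symm
  · rfl
  · rfl

@[simp]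
theorem update_pairStk_io (io tmp s : Str) (S : ∀ b k, List ((M b).Γ k)) :
    update (pairStk M io tmp S) (.inl .io) s = pairStk M s tmp S := by
  funext k
  rcases k with (_ | _) | k <;> rfl

@[simp]
theorem update_pairStk_tmp (io tmp s : Str) (S : ∀ b k, List ((M b).Γ k)) :
    update (pairStk M io tmp S) (.inl .tmp) s = pairStk M io s S := by
  funext k
  rcases k with (_ | _) | k <;> rfl

@[simp]
theorem update_pairStk_inr (io tmp : Str) (S : ∀ b k, List ((M b).Γ k)) (b : Bool) (k : (M b).K)
    (s : List ((M b).Γ k)) :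
    update (pairStk M io tmp S) (.inr ⟨b, k⟩) s =
      pairStk M io tmp (update S b (update (S b) k s)) := by
  refine update_eq_iff.2 ⟨?_, ?_⟩
  · simp [pairStk]
  · rintro ((_ | _) | ⟨b', k'⟩) hk
    · rfl
    · rfl
    · rcases eq_or_ne b' b with rfl | hb
      · have : k' ≠ k := by rintro rfl; exact hk rfl
        simp [pairStk, this]
      · simp [pairStk, hb]

theorem overwrite_pairStk (io tmp : Str) (S : ∀ b k, List ((M b).Γ k)) (b : Bool)
    (T : ∀ k, List ((M b).Γ k)) :
    (pairSubroutine M b).overwrite (pairStk M io tmp S) T = pairStk M io tmp (update S b T) := by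
  refine Eq.symm <| (pairSubroutine M b).eq_overwrite_iff.2 ⟨fun k => ?_, fun j hj => ?_⟩
  · exact congrFun (update_self b T S) k
  · rcases j with (_ | _) | ⟨b', k⟩
    · rfl
    · rfl
    · have : b' ≠ b := by rintro rfl; exact hj k rfl
      exact congrFun (update_of_ne this T S) k

theorem update_true_update_false {C : Bool → Type*} (S T : ∀ b, C b) :
    update (update S true (T true)) false (T false) = T := by
  funext b
  cases b <;> rfl

theorem update_nil {K : Type*} [DecidableEq K] {Γ : K → Type*} (k : K) :
    update (fun k => ([] : List (Γ k))) k [] = fun _ => [] :=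
  update_eq_self k _

variable (M) in
/-- The configuration of the machine for `PolyTime.pair` at label `l` with initial internal state
and the given stack contents. -/
def pairCfg (l : PairLabels M) (io tmp : Str) (S : ∀ b k, List ((M b).Γ k)) :
    Cfg (PairAlphabet M) (PairLabels M) (PairState M) :=
  ⟨some l, pairStart M, pairStk M io tmp S⟩

theorem stepAux_pairFinish_true (io : Str) (S : ∀ b k, List ((M b).Γ k)) :
    stepAux (pairFinish M true) (pairStart M) (pairStk M io [] S) =
      pairCfg M (.inr ⟨false, (M false).main⟩) (false :: true :: io) [] S := by
  simp [pairFinish, stepAux, pairCfg, pairStk]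

theorem reachesWithin_split (w : Str) (S : ∀ b k, List ((M b).Γ k)) :
    ReachesWithin (TM2.step (pairProg M ei eo)) (w.length + 1)
      (pairCfg M (.inl .split) w [] S) (pairCfg M (.inl .feed) [] w.reverse S) := by
  refine ReachesWithin.foldl (D := fun w v => pairCfg M (.inl .split) w v S)
    (g := fun v x => x :: v) (fun x w v => ?_) ?_
  · simp [TM2.step, pairProg, popCase, clearGoto, stepAux, pairCfg, pairStk]
  · simp [TM2.step, pairProg, popCase, stepAux, pairCfg, pairStk]

theorem reachesWithin_feed (w : Str) :
    ReachesWithin (TM2.step (pairProg M ei eo)) (w.length + 1)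
      (pairCfg M (.inl .feed) [] w fun _ _ => [])
      (pairCfg M (.inr ⟨true, (M true).main⟩) [] []
        fun b => update (fun _ => []) (M b).k₀ (w.reverse.map (ei b).symm)) := by
  let D (w v : Str) := pairCfg M (.inl .feed) [] w
    fun b => update (fun _ => []) (M b).k₀ (v.map (ei b).symm)
  suffices ReachesWithin (TM2.step (pairProg M ei eo)) (w.length + 1) (D w []) _ by
    simpa only [D, List.map_nil, update_nil] using this
  refine ReachesWithin.foldl (g := fun v x => x :: v) (fun x w v => ?_) ?_
  · have push_both := update_true_update_false
      (fun b => update (fun _ => []) (M b).k₀ (v.map (ei b).symm))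
      (fun b => update (fun _ => []) (M b).k₀ ((ei b).symm x :: v.map (ei b).symm))
    simp [D, TM2.step, pairProg, popCase, clearGoto, stepAux, pairCfg, pairStk, push_both]
  · simp [D, TM2.step, pairProg, popCase, stepAux, pairCfg, pairStk]

theorem reachesWithin_drain (b : Bool) (u io : Str) (S : ∀ b k, List ((M b).Γ k)) :
    ReachesWithin (TM2.step (pairProg M ei eo)) (u.length + 1)
      (pairCfg M (.inl (.drain b)) io []
        (update S b (update (fun _ => []) (M b).k₁ (u.map (eo b).symm))))
      (pairCfg M (.inl (.emit b)) io u.reverse (update S b fun _ => [])) := by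
  refine ReachesWithin.foldl (D := fun w v => pairCfg M (.inl (.drain b)) io v
    (update S b (update (fun _ => []) (M b).k₁ (w.map (eo b).symm))))
    (g := fun v x => x :: v) (fun x w v => ?_) ?_
  · simp [TM2.step, pairProg, popCase, clearGoto, stepAux, pairCfg, pairStk]
  · simp [TM2.step, pairProg, popCase, stepAux, pairCfg, pairStk]

theorem reachesWithin_emit (b : Bool) (u io : Str) (S : ∀ b k, List ((M b).Γ k)) :
    ReachesWithin (TM2.step (pairProg M ei eo)) (u.length + 1)
      (pairCfg M (.inl (.emit b)) io u S)
      (stepAux (pairFinish M b) (pairStart M) (pairStk M (double u.reverse ++ io) [] S)) := by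
  refine ReachesWithin.foldl (D := fun w v => pairCfg M (.inl (.emit b)) v w S)
    (g := fun v x => x :: x :: v) (fun x w v => ?_) ?_
  · simp [TM2.step, pairProg, popCase, clearGoto, stepAux, pairCfg, pairStk]
  · rw [foldl_double]
    simp [TM2.step, pairProg, popCase, stepAux, pairCfg, pairStk]

theorem reachesWithin_subroutine (b : Bool) {t : ℕ} {u io : Str} {S : ∀ b k, List ((M b).Γ k)}
    (h : ReachesWithin (TM2.step (M b).m) t ⟨some (M b).main, (M b).initialState, S b⟩
      ⟨none, (M b).initialState, update (fun _ => []) (M b).k₁ (u.map (eo b).symm)⟩) :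
    ReachesWithin (TM2.step (pairProg M ei eo)) (t + (u.length + 1) + (u.length + 1))
      (pairCfg M (.inr ⟨b, (M b).main⟩) io [] S)
      (stepAux (pairFinish M b) (pairStart M)
        (pairStk M (double u ++ io) [] (update S b fun _ => []))) := by
  have run := (pairSubroutine M b).reachesWithin (P' := pairProg M ei eo) (fun _ => rfl)
    (pairStart M) (pairStk M io [] S) h
  have set_start : (pairSubroutine M b).set (pairStart M) (M b).initialState = pairStart M :=
    congrArg _ (update_eq_self b _)
  simp only [Subroutine.liftCfg, overwrite_pairStk, set_start, update_eq_self] at run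
  have drain := run.trans (reachesWithin_drain b u io S)
  have emit := drain.trans (reachesWithin_emit b u.reverse io _)
  rwa [List.reverse_reverse, List.length_reverse] at emit

theorem reachesWithin_pairProg {t : Bool → ℕ} {u : Bool → Str} (w : Str)
    (h : ∀ b, ReachesWithin (TM2.step (M b).m) (t b)
      ⟨some (M b).main, (M b).initialState, update (fun _ => []) (M b).k₀ (w.map (ei b).symm)⟩
      ⟨none, (M b).initialState, update (fun _ => []) (M b).k₁ ((u b).map (eo b).symm)⟩) :
    ReachesWithin (TM2.step (pairProg M ei eo))
      (2 * w.length + t true + 2 * (u true).length + t false + 2 * (u false).length + 6)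
      (pairCfg M (.inl .split) w [] fun _ _ => [])
      ⟨none, pairStart M, pairStk M (pair (u false) (u true)) [] fun _ _ => []⟩ := by
  have load := (reachesWithin_split (ei := ei) (eo := eo) w fun _ _ => []).trans
    (reachesWithin_feed w.reverse)
  rw [List.reverse_reverse] at load
  have run_true := load.trans (reachesWithin_subroutine true (h true))
  rw [stepAux_pairFinish_true] at run_true
  have run_false := run_true.trans (reachesWithin_subroutine false (S := update _ _ _) (h false))
  rw [update_true_update_false _ fun _ _ => [], List.append_nil, ← pair_eq] at run_false
  refine run_false.mono ?_
  simp only [List.length_reverse]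
  omega

end PairMachine

theorem PolyTime.pair {f g : Str → Str} (hf : PolyTime f) (hg : PolyTime g) :
    PolyTime fun w => pair (f w) (g w) := by
  have components (b : Bool) : PolyTime (cond b g f) := by cases b <;> assumption
  choose M ei eo p h using fun b => polyTime_iff.1 (components b)
  obtain ⟨q, hq⟩ := hf.exists_length_le
  obtain ⟨r, hr⟩ := hg.exists_length_le
  refine polyTime_iff.2 ⟨pairTM M ei eo, .refl Bool, .refl Bool,
    2 * .X + p true + 2 * r + p false + 2 * q + 6, fun w => ?_⟩
  simp only [Polynomial.eval_add, Polynomial.eval_mul, Polynomial.eval_X, Polynomial.eval_ofNat]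
  have run := (reachesWithin_pairProg w fun b => h b w).mono
    (t := 2 * w.length + (p true).eval w.length + 2 * r.eval w.length + (p false).eval w.length
      + 2 * q.eval w.length + 6) (by have := hq w; have := hr w; simp only [cond]; omega)
  rw [pairCfg, pairStk_io, pairStk_io] at run
  exact run

end PolyTime

section TailSetoid

/-- The equivalence relation that identifies two distinct strings if they differ in the first
symbol only and the rest of both is in `A`. -/
def tailSetoid (A : Language Bool) : Setoid Str where
  r x y := x = y ∨ ∃ a b, ∃ w ∈ A, x = a :: w ∧ y = b :: w
  iseqv :=
    { refl := fun _ => .inl rfl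
      symm := by
        rintro x y (rfl | ⟨a, b, w, hw, rfl, rfl⟩)
        · exact .inl rfl
        · exact .inr ⟨b, a, w, hw, rfl, rfl⟩
      trans := by
        rintro x y z (rfl | ⟨a, b, w, hw, rfl, rfl⟩) (rfl | ⟨a', b', w', hw', h, rfl⟩)
        · exact .inl rfl
        · exact .inr ⟨a', b', w', hw', h, rfl⟩
        · exact .inr ⟨a, b, w, hw, rfl, rfl⟩
        · obtain ⟨rfl, rfl⟩ := List.cons.inj h
          exact .inr ⟨a, b', w, hw, rfl, rfl⟩ }

variable {A : Language Bool} {a b : Bool} {x y w : Str}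

theorem length_eq_of_tailSetoid (h : tailSetoid A x y) : x.length = y.length := by
  rcases h with rfl | ⟨a, b, w, -, rfl, rfl⟩ <;> rfl

theorem tailSetoid_append_cons (hab : a ≠ b) :
    tailSetoid A (x ++ a :: w) (y ++ b :: w) ↔ x = [] ∧ y = [] ∧ w ∈ A := by
  constructor
  · intro h
    have same_length : x.length = y.length := by
      have := length_eq_of_tailSetoid h
      simp only [List.length_append, List.length_cons] at this
      omega
    rcases h with h | ⟨c, d, u, hu, hx, hy⟩
    · exact absurd (List.cons.inj (List.append_inj h same_length).2).1 hab
    · cases x with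
      | nil =>
        obtain rfl : y = [] := List.length_eq_zero_iff.1 same_length.symm
        exact ⟨rfl, rfl, (List.cons.inj hx).2 ▸ hu⟩
      | cons _ x =>
        obtain _ | ⟨_, y⟩ := y
        · cases same_length
        · have h := (List.cons.inj hx).2.trans (List.cons.inj hy).2.symm
          have := (List.append_inj h (Nat.succ.inj same_length)).2
          exact absurd (List.cons.inj this).1 hab
  · rintro ⟨rfl, rfl, hw⟩
    exact .inr ⟨a, b, w, hw, rfl, rfl⟩

theorem tailSetoid_cons (hab : a ≠ b) : tailSetoid A (a :: w) (b :: w) ↔ w ∈ A := by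
  simpa using tailSetoid_append_cons (x := []) (y := []) hab

end TailSetoid

namespace NTM

/-- All computation paths from `c` have at most `t` steps, and one of them accepts if and only if
`Q` holds. -/
def Decides (N : NTM) (c : N.Cfg) (t : ℕ) (Q : Prop) : Prop :=
  (∀ n d, N.ReachesIn n c d → n ≤ t) ∧
    (Q ↔ ∃ n d, N.ReachesIn n c d ∧ d.l = none ∧ d.var ∈ N.accept)

namespace Decides

variable {N N' : NTM} {t t' : ℕ} {Q Q' : Prop}

theorem mono {c : N.Cfg} (h : N.Decides c t Q) (ht : t ≤ t') (hQ : Q' ↔ Q) : N.Decides c t' Q' :=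
  ⟨fun n d hd => (h.1 n d hd).trans ht, hQ.trans h.2⟩

theorem halted {v : N.σ} {S : ∀ k, List (N.Γ k)} (t : ℕ) (hQ : Q ↔ v ∈ N.accept) :
    N.Decides ⟨none, v, S⟩ t Q := by
  have stays : ∀ n d, N.ReachesIn n ⟨none, v, S⟩ d → n = 0 ∧ d = ⟨none, v, S⟩ := by
    rintro (_ | n) d h
    · exact ⟨rfl, h.symm⟩
    · obtain ⟨_, ⟨_, hl, -⟩, -⟩ := h
      cases hl
  refine ⟨fun n d h => (stays n d h).1.trans_le (Nat.zero_le t), hQ.trans ⟨?_, ?_⟩⟩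
  · exact fun hv => ⟨0, _, rfl, rfl, hv⟩
  · rintro ⟨n, d, h, -, hd⟩
    obtain ⟨-, rfl⟩ := stays n d h
    exact hd

theorem step {l : N.Λ} {v : N.σ} {S : ∀ k, List (N.Γ k)} {q : Stmt N.Γ N.Λ N.σ}
    (hq : N.prog l = [q]) (h : N.Decides (stepAux q v S) t Q) :
    N.Decides ⟨some l, v, S⟩ (t + 1) Q := by
  have step_iff (d : N.Cfg) : N.Step ⟨some l, v, S⟩ d ↔ d = stepAux q v S := by
    simp [Step, hq]
  refine ⟨?_, h.2.trans ⟨?_, ?_⟩⟩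
  · rintro (_ | n) d hd
    · exact Nat.zero_le _
    · obtain ⟨_, he, hd⟩ := hd
      obtain rfl := (step_iff _).1 he
      exact Nat.succ_le_succ (h.1 n d hd)
  · rintro ⟨n, d, hd, accepts⟩
    exact ⟨n + 1, d, ⟨_, (step_iff _).2 rfl, hd⟩, accepts⟩
  · rintro ⟨_ | n, d, hd, accepts⟩
    · cases hd
      cases accepts.1
    · obtain ⟨_, he, hd⟩ := hd
      obtain rfl := (step_iff _).1 he
      exact ⟨n, d, hd, accepts⟩

theorem map (φ : N.Cfg → N'.Cfg) (step : ∀ c d, N'.Step (φ c) d ↔ ∃ e, N.Step c e ∧ d = φ e)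
    (accept : ∀ c, (φ c).l = none ∧ (φ c).var ∈ N'.accept ↔ c.l = none ∧ c.var ∈ N.accept)
    {c : N.Cfg} (h : N.Decides c t Q) : N'.Decides (φ c) t Q := by
  have reaches_iff (n : ℕ) (c : N.Cfg) (d : N'.Cfg) :
      N'.ReachesIn n (φ c) d ↔ ∃ e, N.ReachesIn n c e ∧ d = φ e := by
    induction n generalizing c with
    | zero => simp [ReachesIn, eq_comm]
    | succ n ih =>
      simp only [ReachesIn, step]
      constructor
      · rintro ⟨_, ⟨e, he, rfl⟩, hd⟩
        obtain ⟨d, hd', rfl⟩ := (ih e).1 hd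
        exact ⟨d, ⟨e, he, hd'⟩, rfl⟩
      · rintro ⟨d, ⟨e, he, hd⟩, rfl⟩
        exact ⟨φ e, ⟨e, he, rfl⟩, (ih e).2 ⟨d, hd, rfl⟩⟩
  refine ⟨fun n d hd => ?_, h.2.trans ⟨?_, ?_⟩⟩
  · obtain ⟨e, he, -⟩ := (reaches_iff n c d).1 hd
    exact h.1 n e he
  · rintro ⟨n, d, hd, accepts⟩
    exact ⟨n, φ d, (reaches_iff n c _).2 ⟨d, hd, rfl⟩, (accept d).2 accepts⟩
  · rintro ⟨n, _, hd, accepts⟩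
    obtain ⟨d, hd', rfl⟩ := (reaches_iff n c _).1 hd
    exact ⟨n, d, hd', (accept d).1 accepts⟩

end Decides

end NTM

section TailMachine

/-- The stacks that the machine for `inNP_inducedLang_tailSetoid` has in addition to those of its
subroutine: the input, and the two strings of which it is the encoded pair. -/
inductive TailStack
  | inp | xs | ys
  deriving DecidableEq

instance : Fintype TailStack := ⟨{.inp, .xs, .ys}, fun k => by cases k <;> simp⟩

/-- The phases of the machine for `inNP_inducedLang_tailSetoid` before the run of its subroutine.
The two strings are read (`fst`, `snd`) onto one stack each, and are then compared from their ends
while their common part is moved to the input stack of the subroutine (`compare`). At the first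
difference, both of them must be exhausted (`last`) for the subroutine to be started. -/
inductive TailLabel
  | fst | snd | compare | last
  deriving DecidableEq

instance : Fintype TailLabel := ⟨{.fst, .snd, .compare, .last}, fun l => by cases l <;> simp⟩

/-- The internal states of the machine for `inNP_inducedLang_tailSetoid`: the two symbols read last,
the answer if it is given without running the subroutine, and the state of the subroutine. -/
structure TailState (σ : Type) where
  fst : Option Bool
  snd : Option Bool
  answer : Option Bool
  sub : σ
  deriving Fintype

variable (N : NTM)

/-- The stack alphabets of `tailNTM N`. -/
abbrev TailAlphabet : TailStack ⊕ N.K → Type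
  | .inl _ => Bool
  | .inr k => N.Γ k

instance (k : TailStack ⊕ N.K) : Fintype (TailAlphabet N k) :=
  match k with
  | .inl _ => inferInstanceAs (Fintype Bool)
  | .inr k => N.finΓ k

/-- The statements of `tailNTM N`. -/
abbrev TailStmt : Type := Stmt (TailAlphabet N) (TailLabel ⊕ N.Λ) (TailState N.σ)

/-- Pops a symbol off each of the stacks `j` and `k`, and continues with `same` if both symbols
exist and agree, with `empty` if both stacks were empty, and with `other` otherwise. -/
def popTwoCases (j k : TailStack) (same empty other : TailStmt N) : TailStmt N :=
  .pop (.inl j) (fun s a => { s with fst := a }) <|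
  .pop (.inl k) (fun s a => { s with snd := a }) <|
  .branch (fun s => s.fst == s.snd) (.branch (fun s => s.fst.isSome) same empty) other

/-- Clears the registers for the symbols read last and continues at the label `l`. -/
def resetGoto (l : TailLabel ⊕ N.Λ) : TailStmt N :=
  .load (fun s => { s with fst := none, snd := none }) (.goto fun _ => l)

/-- Halts with the answer `b`. -/
def haltWith (b : Bool) : TailStmt N := .load (fun s => { s with answer := some b }) .halt

/-- `N` as a subroutine of `tailNTM N`. -/
def tailSubroutine :
    Subroutine N.K N.Λ N.σ (TailAlphabet N) (TailLabel ⊕ N.Λ) (TailState N.σ) where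
  stack := ⟨.inr, Sum.inr_injective⟩
  label := .inr
  get s := s.sub
  set s v := { s with sub := v }
  get_set _ _ := rfl
  set_set _ _ _ := rfl
  exit := .halt

/-- The program of `tailNTM N` before the run of `N`. -/
def tailProg : TailLabel → TailStmt N
  | .fst => popTwoCases N .inp .inp
      (.push (.inl .xs) (fun s => s.fst.getD false) <| resetGoto N (.inl .fst))
      (haltWith N false)
      (.branch (fun s => s.fst == some false && s.snd == some true)
        (resetGoto N (.inl .snd)) (haltWith N false))
  | .snd => popTwoCases N .inp .inp
      (.push (.inl .ys) (fun s => s.fst.getD false) <| resetGoto N (.inl .snd))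
      (resetGoto N (.inl .compare))
      (haltWith N false)
  | .compare => popTwoCases N .xs .ys
      (.push (.inr N.k₀) (fun s => N.inp (s.fst.getD false)) <| resetGoto N (.inl .compare))
      (haltWith N true)
      (.branch (fun s => s.fst.isSome && s.snd.isSome)
        (resetGoto N (.inl .last)) (haltWith N false))
  | .last => popTwoCases N .xs .ys
      (haltWith N false) (resetGoto N (.inr N.main)) (haltWith N false)

/-- If `N` decides `A`, then this machine decides the language induced by `tailSetoid A`. -/
def tailNTM : NTM where
  K := TailStack ⊕ N.K
  Γ := TailAlphabet N
  k₀ := .inl .inp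
  inp := .refl Bool
  Λ := TailLabel ⊕ N.Λ
  main := .inl .fst
  σ := TailState N.σ
  start := ⟨none, none, none, N.start⟩
  accept := {s | s.answer = some true ∨ s.answer = none ∧ s.sub ∈ N.accept}
  prog
    | .inl l => [tailProg N l]
    | .inr l => (N.prog l).map (tailSubroutine N).liftStmt

/-- The stack contents of `tailNTM N`. -/
def tailStk (z x y : Str) (S : ∀ k, List (N.Γ k)) : ∀ k, List (TailAlphabet N k)
  | .inl .inp => z
  | .inl .xs => x
  | .inl .ys => y
  | .inr k => S k

/-- The configuration of `tailNTM N` at label `l` with initial internal state, with `z`, `x`, `y` on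
its own stacks and `w` on the input stack of `N`. -/
def tailCfg (l : TailLabel ⊕ N.Λ) (z x y w : Str) : (tailNTM N).Cfg :=
  ⟨some l, (tailNTM N).start, tailStk N z x y (update (fun _ => []) N.k₀ (w.map N.inp))⟩

variable {N} {A : Language Bool} {z x y w : Str} {T m : ℕ}

theorem tailNTM_init : (tailNTM N).init z = tailCfg N (.inl .fst) z [] [] [] := by
  refine congrArg (Cfg.mk _ _) (funext fun k => ?_)
  rcases k with (_ | _ | _) | k
  · exact List.map_id z
  · rfl
  · rfl
  · exact (congrFun (update_nil N.k₀) k).symm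

section

variable {S : ∀ k, List (N.Γ k)}

@[simp]
theorem update_tailStk_inp (s : Str) :
    update (tailStk N z x y S) (.inl .inp) s = tailStk N s x y S := by
  funext k
  rcases k with (_ | _ | _) | k <;> rfl

@[simp]
theorem update_tailStk_xs (s : Str) :
    update (tailStk N z x y S) (.inl .xs) s = tailStk N z s y S := by
  funext k
  rcases k with (_ | _ | _) | k <;> rfl

@[simp]
theorem update_tailStk_ys (s : Str) :
    update (tailStk N z x y S) (.inl .ys) s = tailStk N z x s S := by
  funext k
  rcases k with (_ | _ | _) | k <;> rfl

@[simp]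
theorem update_tailStk_inr (k : N.K) (s : List (N.Γ k)) :
    update (tailStk N z x y S) (.inr k) s = tailStk N z x y (update S k s) := by
  refine update_eq_iff.2 ⟨?_, ?_⟩
  · simp [tailStk]
  · rintro ((_ | _ | _) | k') hk
    · rfl
    · rfl
    · rfl
    · have : k' ≠ k := by rintro rfl; exact hk rfl
      simp [tailStk, this]

theorem overwrite_tailStk (T : ∀ k, List (N.Γ k)) :
    (tailSubroutine N).overwrite (tailStk N z x y S) T = tailStk N z x y T := by
  refine Eq.symm <| (tailSubroutine N).eq_overwrite_iff.2 ⟨fun _ => rfl, fun j hj => ?_⟩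
  rcases j with (_ | _ | _) | k
  · rfl
  · rfl
  · rfl
  · exact absurd rfl (hj k)

end

theorem tailNTM_step_liftCfg_iff {s : TailState N.σ} {S : ∀ k, List (TailAlphabet N k)} {c : N.Cfg}
    {d : (tailNTM N).Cfg} :
    (tailNTM N).Step ((tailSubroutine N).liftCfg s S c) d ↔
      ∃ e, N.Step c e ∧ d = (tailSubroutine N).liftCfg s S e := by
  obtain ⟨_ | l, v, T⟩ := c
  · constructor
    · rintro ⟨_, ⟨⟩, -⟩
    · rintro ⟨_, ⟨_, ⟨⟩, -⟩, -⟩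
  · constructor
    · rintro ⟨_, ⟨⟩, _, hq', rfl⟩
      obtain ⟨q, hq, rfl⟩ := List.mem_map.1 hq'
      exact ⟨_, ⟨l, rfl, q, hq, rfl⟩, (tailSubroutine N).stepAux_liftStmt ..⟩
    · rintro ⟨_, ⟨_, ⟨⟩, q, hq, rfl⟩, rfl⟩
      exact ⟨.inr l, rfl, _, List.mem_map_of_mem hq,
        ((tailSubroutine N).stepAux_liftStmt ..).symm⟩

theorem decides_main {t : ℕ} {Q : Prop} (h : N.Decides (N.init w) t Q) :
    (tailNTM N).Decides (tailCfg N (.inr N.main) [] [] [] w) t Q := by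
  have start : tailCfg N (.inr N.main) [] [] [] w =
      (tailSubroutine N).liftCfg (tailNTM N).start (tailStk N [] [] [] fun _ => [])
        (N.init w) :=
    congrArg (Cfg.mk _ _) (overwrite_tailStk _).symm
  rw [start]
  refine h.map _ (fun _ _ => tailNTM_step_liftCfg_iff) fun c => ?_
  obtain ⟨_ | l, v, S⟩ := c
  · exact ⟨fun h => ⟨rfl, (h.2.resolve_left nofun).2⟩, fun h => ⟨rfl, .inr ⟨rfl, h.2⟩⟩⟩
  · constructor <;> rintro ⟨⟨⟩, -⟩

section

variable {l : TailLabel} {t : ℕ} {Q : Prop}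

theorem decides_of_step {c : (tailNTM N).Cfg}
    (hc : stepAux (tailProg N l) (tailNTM N).start (tailCfg N (.inl l) z x y w).stk = c)
    (h : (tailNTM N).Decides c t Q) : (tailNTM N).Decides (tailCfg N (.inl l) z x y w) (t + 1) Q :=
  .step rfl (hc ▸ h)

theorem decides_of_halt {b : Bool}
    (hc : ∃ s S, stepAux (tailProg N l) (tailNTM N).start (tailCfg N (.inl l) z x y w).stk =
      stepAux (haltWith N b) s S) (hQ : Q ↔ b) :
    (tailNTM N).Decides (tailCfg N (.inl l) z x y w) (t + 1) Q := by
  obtain ⟨s, S, hc⟩ := hc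
  refine decides_of_step hc (.halted t (hQ.trans ⟨fun h => .inl (congrArg some h), ?_⟩))
  rintro (h | h)
  · exact Option.some.inj h
  · cases h.1

theorem decides_last (h : N.Decides (N.init w) t Q) :
    (tailNTM N).Decides (tailCfg N (.inl .last) [] x y w) (t + 1) (x = [] ∧ y = [] ∧ Q) := by
  rcases x with _ | ⟨a, x⟩ <;> rcases y with _ | ⟨b, y⟩
  · refine decides_of_step ?_ (.mono (decides_main h) le_rfl (by simp))
    simp [tailCfg, tailProg, popTwoCases, resetGoto, stepAux, tailStk, tailNTM]
  · exact decides_of_halt (b := false) ⟨_, _, rfl⟩ (by simp)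
  · exact decides_of_halt (b := false) ⟨_, _, rfl⟩ (by simp)
  · refine decides_of_halt (b := false) ?_ (by simp)
    cases a <;> cases b <;> exact ⟨_, _, rfl⟩

end

section

variable (hN : ∀ w : Str, w.length ≤ m → N.Decides (N.init w) T (w ∈ A))
include hN

theorem decides_compare (hm : x.length + w.length ≤ m) :
    (tailNTM N).Decides (tailCfg N (.inl .compare) [] x y w) (T + x.length + 1)
      (tailSetoid A (x.reverse ++ w) (y.reverse ++ w)) := by
  have not_of_length_ne {x y w : Str} (h : x.length ≠ y.length) :
      tailSetoid A (x.reverse ++ w) (y.reverse ++ w) ↔ false :=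
    iff_of_false (fun h' => h (by simpa using length_eq_of_tailSetoid h')) Bool.false_ne_true
  induction x generalizing y w with
  | nil =>
    rcases y with _ | ⟨b, y⟩
    · exact decides_of_halt (b := true) ⟨_, _, rfl⟩ (iff_of_true (.inl rfl) rfl)
    · exact decides_of_halt ⟨_, _, rfl⟩ (not_of_length_ne (by simp))
  | cons a x ih =>
    rcases y with _ | ⟨b, y⟩
    · exact decides_of_halt ⟨_, _, rfl⟩ (not_of_length_ne (by simp))
    rw [List.length_cons] at hm ⊢
    rcases eq_or_ne a b with rfl | hab
    · refine decides_of_step ?_ (.mono (ih (w := a :: w) (y := y) ?_) ?_ ?_)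
      · simp [tailCfg, tailProg, popTwoCases, resetGoto, stepAux, tailStk, tailNTM]
      · rw [List.length_cons]
        omega
      · omega
      · simp
    · refine decides_of_step ?_
        (.mono (decides_last (hN w (by omega)) (x := x) (y := y)) ?_ ?_)
      · have := beq_false_of_ne hab
        simp [tailCfg, tailProg, popTwoCases, resetGoto, stepAux, tailStk, tailNTM, this]
      · omega
      · simpa using tailSetoid_append_cons (x := x.reverse) (y := y.reverse) hab

theorem decides_snd (hm : x.length ≤ m) :
    (tailNTM N).Decides (tailCfg N (.inl .snd) z x y []) (T + x.length + z.length + 2)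
      (∃ v, z = double v ∧ tailSetoid A x.reverse (y.reverse ++ v)) := by
  induction z using List.twoStepInduction generalizing y with
  | nil =>
    refine decides_of_step ?_ (.mono (decides_compare hN (y := y) (w := []) (x := x) hm) ?_ ?_)
    · simp [tailCfg, tailProg, popTwoCases, resetGoto, stepAux, tailStk, tailNTM]
    · simp
    · constructor
      · rintro ⟨_ | ⟨b, v⟩, h, h'⟩
        · simpa using h'
        · cases h
      · exact fun h => ⟨[], rfl, by simpa using h⟩
  | singleton a =>
    refine decides_of_halt (b := false) ?_ (by simp [singleton_ne_double])
    cases a <;> exact ⟨_, _, rfl⟩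
  | cons_cons a b z ih _ =>
    simp only [cons_cons_eq_double_iff]
    rcases eq_or_ne a b with rfl | hab
    · refine decides_of_step ?_ (.mono (ih (y := a :: y)) ?_ ?_)
      · simp [tailCfg, tailProg, popTwoCases, resetGoto, stepAux, tailStk, tailNTM]
      · simp
      · grind
    · refine decides_of_halt (b := false) ?_ (by simp [hab])
      cases a <;> cases b <;> first | exact ⟨_, _, rfl⟩ | exact absurd rfl hab

theorem decides_fst (hm : x.length + z.length ≤ m) :
    (tailNTM N).Decides (tailCfg N (.inl .fst) z x [] []) (T + x.length + z.length + 3)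
      (∃ u v, z = pair u v ∧ tailSetoid A (x.reverse ++ u) v) := by
  have not_of_length_lt {x z : Str} (hz : z.length < 2) :
      (∃ u v, z = pair u v ∧ tailSetoid A (x.reverse ++ u) v) ↔ false := by
    refine iff_of_false ?_ Bool.false_ne_true
    rintro ⟨u, v, rfl, -⟩
    exact absurd (two_le_length_pair u v) hz.not_ge
  induction z using List.twoStepInduction generalizing x with
  | nil => exact decides_of_halt ⟨_, _, rfl⟩ (not_of_length_lt (by simp))
  | singleton a =>
    refine decides_of_halt ?_ (not_of_length_lt (by simp))
    cases a <;> exact ⟨_, _, rfl⟩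
  | cons_cons a b z ih _ =>
    simp only [cons_cons_eq_pair_iff]
    simp only [List.length_cons] at hm ⊢
    rcases eq_or_ne a b with rfl | hab
    · refine decides_of_step ?_ (.mono (ih (x := a :: x) ?_) ?_ ?_)
      · simp [tailCfg, tailProg, popTwoCases, resetGoto, stepAux, tailStk, tailNTM]
      · rw [List.length_cons]
        omega
      · rw [List.length_cons]
        omega
      · grind
    · cases a <;> cases b
      · cases hab rfl
      · refine decides_of_step ?_
          (.mono (decides_snd hN (x := x) (y := []) (z := z) (by omega)) ?_ ?_)
        · simp [tailCfg, tailProg, popTwoCases, resetGoto, stepAux, tailStk, tailNTM]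
        · omega
        · simp
      · exact decides_of_halt (b := false) ⟨_, _, rfl⟩ (by simp)
      · cases hab rfl

end

end TailMachine

theorem inNP_inducedLang_tailSetoid {A : Language Bool} (hA : InNP A) :
    InNP (inducedLang (tailSetoid A)) := by
  obtain ⟨N, p, hN⟩ := hA
  refine ⟨tailNTM N, p + .X + 3, fun z => ?_⟩
  have decides_sub (w : Str) (hw : w.length ≤ z.length) :
      N.Decides (N.init w) (p.eval z.length) (w ∈ A) :=
    .mono ⟨(hN w).1, (hN w).2⟩ (polynomial_eval_mono p hw) Iff.rfl
  have decides := decides_fst (x := []) (z := z) decides_sub (by simp)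
  rw [← tailNTM_init] at decides
  refine decides.mono (by simp) ?_
  constructor
  · rintro ⟨x, y, h, e⟩
    exact ⟨x, y, e, h⟩
  · rintro ⟨x, y, e, h⟩
    exact ⟨x, y, h, e⟩

end KernelRed

theorem mainTheorem11 (R : Setoid (List Bool)) (hR : KernelRed.NPEqComplete R) :
    KernelRed.NPComplete (KernelRed.inducedLang R) := by
  refine ⟨hR.1, fun A hA => ?_⟩
  obtain ⟨f, hf, h⟩ := hR.2 _ (KernelRed.inNP_inducedLang_tailSetoid hA)
  refine ⟨_, (hf.comp_cons false).pair (hf.comp_cons true), fun w => ?_⟩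
  rw [KernelRed.pair_mem_inducedLang, ← h, KernelRed.tailSetoid_cons (by decide)]
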